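/- Let $M,N,K,q$ be positive integers with $K\le N$, and let $0<\delta<3K^{1/(2q)}$ (for instance, any $0<\delta\le 1$). Let $\Phi$ be a random real $M\times N$ matrix whose entries are independent Gaussian random variables with mean $0$ and variance $1/M$. For $\mathcal K\subseteq\{1,\dots,N\}$ let $\Phi_{\mathcal K}$ denote the submatrix of the columns of $\Phi$ indexed by $\mathcal K$, and put $$\delta_{K;q}:=\max_{\mathcal K\subseteq\{1,\dots,N\},\ |\mathcal K|=K}\operatorname{Tr}\big[(\Phi_{\mathcal K}^*\Phi_{\mathcal K}-I_K)^{2q}\big]^{\frac1{2q}}.$$ The matrix $\Phi$ has the $(K,\delta)$-restricted isometry property if $(1-\delta)\|x\|^2\le\|\Phi x\|^2\le(1+\delta)\|x\|^2$ (Euclidean norms) for every vector $x$ with at most $K$ nonzero entries. If $$M\ \ge\ \frac{81}{\delta^2}\,K^{1+1/q}\log\frac{eN}{K},$$ then, with probability at least $1-2\exp\!\big(-K\log\frac{eN}{K}\big)=1-2\big(\frac{K}{eN}\big)^{K}$, we have $\delta_{K;q}\le\delta$ and $\Phi$ has the $(K,\delta)$-restricted isometry property. Moreover, for every realization of $\Phi$,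 the inequality $\delta_{K;q}\le\delta$ implies the $(K,\delta)$-restricted isometry property. -/

import Mathlib

open MeasureTheory ProbabilityTheory
open scoped NNReal Matrix

/-- The submatrix `Φ_S` formed by the columns of `Φ` indexed by `S`. -/
def colSubmatrix {M N : ℕ} (Φ : Matrix (Fin M) (Fin N) ℝ) (S : Finset (Fin N)) :
    Matrix (Fin M) S ℝ :=
  Φ.submatrix id Subtype.val

/-- The power-method estimate
`δ_{K;q} = max_{|S| = K} Tr[(Φ_S* Φ_S - I)^{2q}]^{1/(2q)}`.
The index type is finite (and nonempty when `K ≤ N`), so that the supremum is then a maximum. -/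
noncomputable def powerEstimate {M N : ℕ} (Φ : Matrix (Fin M) (Fin N) ℝ) (K q : ℕ) : ℝ :=
  ⨆ S : {S : Finset (Fin N) // S.card = K},
    ((((colSubmatrix Φ S.1)ᵀ * colSubmatrix Φ S.1 - 1) ^ (2 * q)).trace) ^
      (1 / (2 * (q : ℝ)))

/-- A vector is `K`-sparse if it has at most `K` nonzero entries. -/
def IsSparse {N : ℕ} (K : ℕ) (x : EuclideanSpace ℝ (Fin N)) : Prop :=
  {i | x i ≠ 0}.ncard ≤ K

/-- The `(K, δ)`-restricted isometry property, with Euclidean norms. -/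
def HasRIP {M N : ℕ} (Φ : Matrix (Fin M) (Fin N) ℝ) (K : ℕ) (δ : ℝ) : Prop :=
  ∀ x : EuclideanSpace ℝ (Fin N), IsSparse K x →
    (1 - δ) * ‖x‖ ^ 2 ≤ ‖Matrix.toEuclideanLin Φ x‖ ^ 2 ∧
      ‖Matrix.toEuclideanLin Φ x‖ ^ 2 ≤ (1 + δ) * ‖x‖ ^ 2

/-!
The quantity `δ_{K;q}` is the largest Schatten `2q`-norm of the Gram errors `A_S = Φ_Sᵀ Φ_S - 1`,
`|S| = K`. It dominates their operator norms, which control `‖Φ x‖² - ‖x‖²` on `K`-sparse vectors;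
this gives the restricted isometry property for every realization (`hasRIP_of_powerEstimate_le`).

In the other direction the Schatten norm of a `K × K` matrix is at most `K^(1/2q)` times the operator
norm. So it is enough that, with the stated probability, all the `A_S` have operator norm at most
`ε = δ / K^(1/2q)`. Here `ε < 3`, and the hypothesis on `M` reads `M ε² ≥ 81 K L` with
`L = log (eN/K) ≥ 1`.

The operator norm is bounded with a `1/4`-net of the unit sphere of `ℝ^K` of at most `9^K` points
(`exists_net_unitSphere`). Comparing a top eigenvector with the nearest point of the net loses only a
term quadratic in the mesh, so `|⟪y, A_S y⟫| ≤ (7/8) ε` on the net suffices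
(`Matrix.IsHermitian.abs_eigenvalues_le_of_net`). For a fixed unit vector `y` the coordinates of
`Φ_S y` are independent `N(0, 1/M)`, and the Chernoff bound for their sum of squares gives
`P(|‖Φ_S y‖² - 1| ≥ u) ≤ 2 exp (-(2/29) M u²)` for `0 ≤ u ≤ 21/8`
(`measureReal_abs_norm_sq_sub_one_ge_le`). The range of `u` is what `ε < 3` requires.

A union bound over the at most `exp (K L)` sets `S` and the at most `9^K ≤ exp ((9/4) K L)` points of
each net leaves a failure probability of at most `2 exp ((1 + 9/4 - 81 (2/29) (7/8)²) K L)`, and the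
coefficient of `K L` is below `-1`.
-/

/-! ### Spectral bounds for symmetric matrices and the restricted isometry property -/

namespace Matrix.IsHermitian

variable {n : Type*} [Fintype n] [DecidableEq n] {A : Matrix n n ℝ}

lemma trace_pow_eq_sum_eigenvalues_pow (hA : A.IsHermitian) (m : ℕ) :
    (A ^ m).trace = ∑ i, hA.eigenvalues i ^ m := by
  conv_lhs => rw [hA.spectral_theorem, ← map_pow, Matrix.diagonal_pow]
  rw [Unitary.conjStarAlgAut_apply, Matrix.trace_mul_cycle]
  simp [Matrix.trace_diagonal]

lemma inner_toEuclideanLin_eq_sum (hA : A.IsHermitian) (x : EuclideanSpace ℝ n) :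
    inner ℝ x (toEuclideanLin A x) =
      ∑ i, hA.eigenvalues i * inner ℝ (hA.eigenvectorBasis i) x ^ 2 := by
  have hsymm : (toEuclideanLin A).IsSymmetric := Matrix.isSymmetric_toEuclideanLin_iff.2 hA
  have heig : ∀ i, toEuclideanLin A (hA.eigenvectorBasis i) =
      hA.eigenvalues i • hA.eigenvectorBasis i := fun i => by
    ext j
    simpa [Matrix.toLpLin_apply] using congrFun (hA.mulVec_eigenvectorBasis i) j
  rw [← hA.eigenvectorBasis.sum_inner_mul_inner x]
  refine Finset.sum_congr rfl fun i _ => ?_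
  rw [← hsymm, heig, inner_smul_left, real_inner_comm]
  simp only [conj_trivial]
  rw [real_inner_comm]
  ring

lemma sum_sq_inner_eigenvectorBasis (hA : A.IsHermitian) (x : EuclideanSpace ℝ n) :
    ∑ i, inner ℝ (hA.eigenvectorBasis i) x ^ 2 = ‖x‖ ^ 2 := by
  simpa using hA.eigenvectorBasis.sum_sq_norm_inner_right x

lemma abs_inner_toEuclideanLin_le (hA : A.IsHermitian) {c : ℝ}
    (hc : ∀ i, |hA.eigenvalues i| ≤ c) (x : EuclideanSpace ℝ n) :
    |inner ℝ x (toEuclideanLin A x)| ≤ c * ‖x‖ ^ 2 := by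
  rw [hA.inner_toEuclideanLin_eq_sum, ← hA.sum_sq_inner_eigenvectorBasis, Finset.mul_sum]
  refine (Finset.abs_sum_le_sum_abs _ _).trans (Finset.sum_le_sum fun i _ => ?_)
  rw [abs_mul, abs_sq]
  exact mul_le_mul_of_nonneg_right (hc i) (sq_nonneg _)

lemma trace_pow_two_mul_nonneg (hA : A.IsHermitian) (q : ℕ) : 0 ≤ (A ^ (2 * q)).trace := by
  rw [hA.trace_pow_eq_sum_eigenvalues_pow]
  exact Finset.sum_nonneg fun i _ => (even_two_mul q).pow_nonneg _

lemma abs_eigenvalues_le_trace_rpow (hA : A.IsHermitian) {q : ℕ} (hq : 1 ≤ q) (i : n) :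
    |hA.eigenvalues i| ≤ (A ^ (2 * q)).trace ^ (1 / (2 * (q : ℝ))) := by
  have hle : |hA.eigenvalues i| ^ (2 * q) ≤ (A ^ (2 * q)).trace := by
    rw [(even_two_mul q).pow_abs, hA.trace_pow_eq_sum_eigenvalues_pow]
    exact Finset.single_le_sum (f := fun i => hA.eigenvalues i ^ (2 * q))
      (fun j _ => (even_two_mul q).pow_nonneg _) (Finset.mem_univ i)
  calc |hA.eigenvalues i| = (|hA.eigenvalues i| ^ (2 * q)) ^ (1 / (2 * (q : ℝ))) := by
        rw [one_div]
        exact_mod_cast (Real.pow_rpow_inv_natCast (abs_nonneg _) (by lia : 2 * q ≠ 0)).symm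
    _ ≤ _ := Real.rpow_le_rpow (by positivity) hle (by positivity)

lemma trace_rpow_le (hA : A.IsHermitian) {q : ℕ} (hq : 1 ≤ q) {c : ℝ} (hc0 : 0 ≤ c)
    (hc : ∀ i, |hA.eigenvalues i| ≤ c) :
    (A ^ (2 * q)).trace ^ (1 / (2 * (q : ℝ))) ≤
      (Fintype.card n : ℝ) ^ (1 / (2 * (q : ℝ))) * c := by
  have hle : (A ^ (2 * q)).trace ≤ Fintype.card n * c ^ (2 * q) := by
    rw [hA.trace_pow_eq_sum_eigenvalues_pow, ← nsmul_eq_mul]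
    refine Finset.sum_le_card_nsmul _ _ _ fun i _ => ?_
    rw [← (even_two_mul q).pow_abs]
    exact pow_le_pow_left₀ (abs_nonneg _) (hc i) _
  refine (Real.rpow_le_rpow (hA.trace_pow_two_mul_nonneg q) hle (by positivity)).trans_eq ?_
  rw [Real.mul_rpow (by positivity) (by positivity)]
  congr 1
  rw [one_div]
  exact_mod_cast Real.pow_rpow_inv_natCast hc0 (by lia : 2 * q ≠ 0)

/-- A symmetric quadratic form is controlled by its values on a `1/4`-net of the unit sphere. For a
unit eigenvector `x` of an eigenvalue `lam` of largest modulus and a unit vector `y` with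
`‖x - y‖ ≤ 1/4`, the component of `y` along `x` is at least `31/32`, and the remaining components
contribute at most `|lam| (1 - ⟪x, y⟫²)`; hence `|⟪y, A y⟫| ≥ |lam| (2 (31/32)² - 1) ≥ (7/8) |lam|`.
The loss is quadratic in the mesh of the net. -/
lemma abs_eigenvalues_le_of_net (hA : A.IsHermitian) {T : Finset (EuclideanSpace ℝ n)}
    (hT1 : ∀ y ∈ T, ‖y‖ = 1) (hT : ∀ x, ‖x‖ = 1 → ∃ y ∈ T, ‖x - y‖ ≤ 1 / 4) {c : ℝ}
    (hc : ∀ y ∈ T, |inner ℝ y (toEuclideanLin A y)| ≤ 7 / 8 * c) (i : n) :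
    |hA.eigenvalues i| ≤ c := by
  obtain ⟨k, -, hk⟩ := Finset.exists_max_image Finset.univ (fun i => |hA.eigenvalues i|)
    ⟨i, Finset.mem_univ i⟩
  refine (hk i (Finset.mem_univ i)).trans ?_
  have hx : ‖hA.eigenvectorBasis k‖ = 1 := hA.eigenvectorBasis.orthonormal.1 k
  obtain ⟨y, hyT, hxy⟩ := hT _ hx
  have hy := hT1 y hyT
  set a : ℝ := inner ℝ (hA.eigenvectorBasis k) y with ha
  have hinner : 31 / 32 ≤ a := by
    have h := norm_sub_sq_real (hA.eigenvectorBasis k) y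
    rw [hx, hy] at h
    have : ‖hA.eigenvectorBasis k - y‖ ^ 2 ≤ (1 / 4) ^ 2 := pow_le_pow_left₀ (norm_nonneg _) hxy 2
    linarith
  have hsum := hA.sum_sq_inner_eigenvectorBasis y
  rw [hy, ← Finset.add_sum_erase _ _ (Finset.mem_univ k), ← ha] at hsum
  have hform := hc y hyT
  rw [hA.inner_toEuclideanLin_eq_sum, ← Finset.add_sum_erase _ _ (Finset.mem_univ k), ← ha] at hform
  have hrest : |∑ j ∈ Finset.univ.erase k,
      hA.eigenvalues j * inner ℝ (hA.eigenvectorBasis j) y ^ 2| ≤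
        |hA.eigenvalues k| * (1 - a ^ 2) := by
    have : 1 - a ^ 2 = ∑ j ∈ Finset.univ.erase k, inner ℝ (hA.eigenvectorBasis j) y ^ 2 := by
      linarith
    rw [this, Finset.mul_sum]
    refine (Finset.abs_sum_le_sum_abs _ _).trans (Finset.sum_le_sum fun j _ => ?_)
    rw [abs_mul, abs_sq]
    exact mul_le_mul_of_nonneg_right (hk j (Finset.mem_univ j)) (sq_nonneg _)
  have htri := abs_sub_abs_le_abs_sub (hA.eigenvalues k * a ^ 2)
    (-∑ j ∈ Finset.univ.erase k, hA.eigenvalues j * inner ℝ (hA.eigenvectorBasis j) y ^ 2)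
  rw [sub_neg_eq_add, abs_neg, abs_mul, abs_sq] at htri
  have hsq : 7 / 8 ≤ 2 * a ^ 2 - 1 := by nlinarith
  have := mul_le_mul_of_nonneg_left hsq (abs_nonneg (hA.eigenvalues k))
  linarith

end Matrix.IsHermitian

lemma isHermitian_gram_sub_one {m n : Type*} [Fintype m] [DecidableEq n]
    (B : Matrix m n ℝ) : (Bᵀ * B - 1).IsHermitian := by
  have := Matrix.isHermitian_conjTranspose_mul_self B
  rw [Matrix.conjTranspose_eq_transpose_of_trivial] at this
  exact this.sub Matrix.isHermitian_one

lemma inner_gram_sub_one {m n : Type*} [Fintype m] [Fintype n] [DecidableEq n]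
    (B : Matrix m n ℝ) (x : EuclideanSpace ℝ n) :
    inner ℝ x (Matrix.toEuclideanLin (Bᵀ * B - 1) x) =
      ‖Matrix.toEuclideanLin B x‖ ^ 2 - ‖x‖ ^ 2 := by
  rw [← real_inner_self_eq_norm_sq, ← real_inner_self_eq_norm_sq]
  simp only [Matrix.toLpLin_apply, EuclideanSpace.inner_eq_star_dotProduct, star_trivial,
    Matrix.sub_mulVec, Matrix.one_mulVec, sub_dotProduct, ← Matrix.mulVec_mulVec]
  rw [dotProduct_comm (Bᵀ *ᵥ _), Matrix.dotProduct_mulVec, Matrix.vecMul_transpose]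

lemma exists_restriction_of_support_subset {M N : ℕ} (Φ : Matrix (Fin M) (Fin N) ℝ)
    (S : Finset (Fin N)) (x : EuclideanSpace ℝ (Fin N)) (hx : ∀ i, x i ≠ 0 → i ∈ S) :
    ∃ z : EuclideanSpace ℝ S, ‖z‖ = ‖x‖ ∧
      Matrix.toEuclideanLin (colSubmatrix Φ S) z = Matrix.toEuclideanLin Φ x := by
  refine ⟨WithLp.toLp 2 fun i => x i, ?_, ?_⟩
  · rw [EuclideanSpace.norm_eq, EuclideanSpace.norm_eq]
    congr 1
    simp only
    rw [Finset.sum_coe_sort S (fun i => ‖x i‖ ^ 2)]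
    refine Finset.sum_subset (Finset.subset_univ S) fun i _ hi => ?_
    simp [not_not.1 fun h => hi (hx i h)]
  · ext i
    simp only [Matrix.toLpLin_apply, Matrix.mulVec, dotProduct, colSubmatrix,
      Matrix.submatrix_apply, id]
    rw [Finset.sum_coe_sort S (fun j => Φ i j * x j)]
    refine Finset.sum_subset (Finset.subset_univ S) fun j _ hj => ?_
    simp [not_not.1 fun h => hj (hx j h)]

lemma trace_rpow_le_powerEstimate {M N : ℕ} (Φ : Matrix (Fin M) (Fin N) ℝ) (q : ℕ)
    (S : Finset (Fin N)) :
    (((colSubmatrix Φ S)ᵀ * colSubmatrix Φ S - 1) ^ (2 * q)).trace ^ (1 / (2 * (q : ℝ))) ≤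
      powerEstimate Φ S.card q :=
  le_ciSup (f := fun S' : {S' : Finset (Fin N) // S'.card = S.card} =>
    (((colSubmatrix Φ S'.1)ᵀ * colSubmatrix Φ S'.1 - 1) ^ (2 * q)).trace ^ (1 / (2 * (q : ℝ))))
    (Set.finite_range _).bddAbove ⟨S, rfl⟩

/-- The power estimate dominates the restricted isometry constant: each `|λ|` is at most
`(∑ λ^{2q})^{1/(2q)}`. -/
theorem hasRIP_of_powerEstimate_le {M N K q : ℕ} (hKN : K ≤ N) (hq : 1 ≤ q) {δ : ℝ}
    {Φ : Matrix (Fin M) (Fin N) ℝ} (h : powerEstimate Φ K q ≤ δ) : HasRIP Φ K δ := by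
  intro x hx
  -- A set of exactly `K` columns containing the support exists because `K ≤ N`.
  obtain ⟨S, hxS, rfl⟩ : ∃ S : Finset (Fin N), Finset.univ.filter (fun i => x i ≠ 0) ⊆ S ∧
      S.card = K := by
    refine Finset.exists_superset_card_eq ?_ (by simpa using hKN)
    rw [IsSparse, Set.ncard_eq_toFinset_card'] at hx
    simpa using hx
  obtain ⟨z, hz, hzΦ⟩ := exists_restriction_of_support_subset Φ S x
    fun i hi => hxS (by simpa using hi)
  have hA := isHermitian_gram_sub_one (colSubmatrix Φ S)
  have habs := hA.abs_inner_toEuclideanLin_le (fun i => (hA.abs_eigenvalues_le_trace_rpow hq i).trans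
    ((trace_rpow_le_powerEstimate Φ q S).trans h)) z
  rw [inner_gram_sub_one, hz, hzΦ, abs_le] at habs
  constructor <;> linarith [habs.1, habs.2]

/-! ### Nets of the unit sphere -/

section Net
open Module Metric
open scoped ENNReal

variable {E : Type*} [NormedAddCommGroup E] [NormedSpace ℝ E] [FiniteDimensional ℝ E]

/-- Volume bound: the balls of radius `r / 2` around the points are disjoint and lie in the ball of
radius `1 + r / 2`. -/
lemma card_le_of_separated_of_norm_le_one {r : ℝ} (hr : 0 < r) (s : Finset E)
    (hs : ∀ c ∈ s, ‖c‖ ≤ 1) (h : ∀ c ∈ s, ∀ d ∈ s, c ≠ d → r ≤ ‖c - d‖) :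
    (s.card : ℝ) ≤ (1 + 2 / r) ^ finrank ℝ E := by
  borelize E
  let μ : Measure E := Measure.addHaar
  have hr2 : 0 < r / 2 := by positivity
  have hρ : 0 < 1 + r / 2 := by positivity
  have hdisj : Set.Pairwise (s : Set E) (Function.onFun Disjoint fun c => ball (c : E) (r / 2)) := by
    intro c hc d hd hcd
    apply ball_disjoint_ball
    rw [dist_eq_norm]
    linarith [h c hc d hd hcd]
  have hsub : ⋃ c ∈ s, ball (c : E) (r / 2) ⊆ ball (0 : E) (1 + r / 2) := by
    refine Set.iUnion₂_subset fun x hx => ball_subset_ball' ?_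
    rw [dist_zero_right]
    linarith [hs x hx]
  have hvol : (s.card : ℝ≥0∞) * ENNReal.ofReal ((r / 2) ^ finrank ℝ E) * μ (ball 0 1) ≤
      ENNReal.ofReal ((1 + r / 2) ^ finrank ℝ E) * μ (ball 0 1) :=
    calc
      _ = μ (⋃ c ∈ s, ball (c : E) (r / 2)) := by
        rw [measure_biUnion_finset hdisj fun c _ => measurableSet_ball]
        simp only [μ.addHaar_ball_of_pos _ hr2, Finset.sum_const, nsmul_eq_mul, mul_assoc]
      _ ≤ μ (ball (0 : E) (1 + r / 2)) := measure_mono hsub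
      _ = _ := by simp only [μ.addHaar_ball_of_pos _ hρ]
  have hcard : (s.card : ℝ≥0∞) * ENNReal.ofReal ((r / 2) ^ finrank ℝ E) ≤
      ENNReal.ofReal ((1 + r / 2) ^ finrank ℝ E) :=
    (ENNReal.mul_le_mul_iff_left (measure_ball_pos _ _ zero_lt_one).ne' measure_ball_lt_top.ne).1
      hvol
  have hreal := ENNReal.toReal_le_of_le_ofReal (by positivity) hcard
  rw [ENNReal.toReal_mul, ENNReal.toReal_natCast, ENNReal.toReal_ofReal (by positivity),
    ← le_div_iff₀ (by positivity), ← div_pow] at hreal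
  refine hreal.trans_eq (congrArg (· ^ finrank ℝ E) ?_)
  field_simp
  ring

/-- The unit sphere has a `1/4`-net of at most `9 ^ d` points: a maximal `1/4`-separated subset. -/
lemma exists_net_unitSphere : ∃ T : Finset E, T.card ≤ 9 ^ finrank ℝ E ∧ (∀ y ∈ T, ‖y‖ = 1) ∧
    ∀ x : E, ‖x‖ = 1 → ∃ y ∈ T, ‖x - y‖ ≤ 1 / 4 := by
  have hcard : ∀ C : Finset E, (C : Set E) ⊆ sphere 0 1 → IsSeparated ((1 / 4 : ℝ≥0) : ℝ≥0∞)
      (C : Set E) → C.card ≤ 9 ^ finrank ℝ E := by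
    intro C hC hsep
    have := card_le_of_separated_of_norm_le_one (r := 1 / 4) (by norm_num) C
      (fun c hc => (mem_sphere_zero_iff_norm.1 (hC hc)).le) fun c hc d hd hcd => by
        have h : ((1 / 4 : ℝ≥0) : ℝ≥0∞) < edist c d := hsep hc hd hcd
        rw [edist_nndist, ENNReal.coe_lt_coe, ← NNReal.coe_lt_coe, coe_nndist, dist_eq_norm] at h
        exact le_of_lt (by simpa using h)
    norm_num at this
    exact_mod_cast this
  have hpack : packingNumber (1 / 4 : ℝ≥0) (sphere (0 : E) 1) ≤ (9 ^ finrank ℝ E : ℕ) := by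
    refine iSup_le fun C => iSup_le fun hC => iSup_le fun hsep => ?_
    by_contra! hlt
    obtain ⟨D, hDC, hD⟩ := Set.exists_subset_encard_eq (Order.add_one_le_of_lt hlt)
    have hfin : D.Finite := Set.finite_of_encard_eq_coe
      (k := 9 ^ finrank ℝ E + 1) (by rw [hD]; push_cast; rfl)
    have := hcard hfin.toFinset (by simpa using hDC.trans hC) (by simpa using hsep.subset hDC)
    rw [hfin.encard_eq_coe_toFinset_card] at hD
    have hD' : hfin.toFinset.card = 9 ^ finrank ℝ E + 1 := by exact_mod_cast hD
    lia
  have htop : packingNumber (1 / 4 : ℝ≥0) (sphere (0 : E) 1) ≠ ⊤ :=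
    (hpack.trans_lt (ENat.natCast_lt_top _)).ne
  have henc := (encard_maximalSeparatedSet htop).trans_le hpack
  have hfin := Set.finite_of_encard_le_coe henc
  refine ⟨hfin.toFinset, ?_, fun y hy => ?_, fun x hx => ?_⟩
  · rw [hfin.encard_eq_coe_toFinset_card] at henc
    exact_mod_cast henc
  · exact mem_sphere_zero_iff_norm.1 (maximalSeparatedSet_subset (hfin.mem_toFinset.1 hy))
  · obtain ⟨y, hy, hxy⟩ := isCover_maximalSeparatedSet htop (mem_sphere_zero_iff_norm.2 hx)
    refine ⟨y, hfin.mem_toFinset.2 hy, ?_⟩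
    have : edist x y ≤ ((1 / 4 : ℝ≥0) : ℝ≥0∞) := hxy
    rw [edist_nndist, ENNReal.coe_le_coe, ← NNReal.coe_le_coe, coe_nndist, dist_eq_norm] at this
    simpa using this

end Net

/-! ### Concentration of the squared norm of a Gaussian image -/

section Tail

variable {Ω : Type*} [MeasurableSpace Ω] {P : Measure Ω}

lemma mgf_sq_of_hasLaw_gaussianReal {X : Ω → ℝ} {v : ℝ≥0} (hv : v ≠ 0)
    (hX : HasLaw X (gaussianReal 0 v) P) {t : ℝ} (ht : 2 * t * v < 1) :
    mgf (fun ω => X ω ^ 2) P t = (√(1 - 2 * t * v))⁻¹ := by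
  have hv' : (0 : ℝ) < v := by positivity
  have h1 : mgf (fun ω => X ω ^ 2) P t = ∫ x, Real.exp (t * x ^ 2) ∂gaussianReal 0 v :=
    hX.integral_comp (f := fun x => Real.exp (t * x ^ 2))
      (Measurable.aestronglyMeasurable (by fun_prop))
  have h2 : ∀ x : ℝ, gaussianPDFReal 0 v x • Real.exp (t * x ^ 2) =
      (√(2 * Real.pi * v))⁻¹ * Real.exp (-((1 - 2 * t * v) / (2 * v)) * x ^ 2) := fun x => by
    rw [gaussianPDFReal, smul_eq_mul, mul_assoc, ← Real.exp_add]
    congr 2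
    field_simp
    ring
  have h3 : 0 < 1 - 2 * t * v := by linarith
  rw [h1, integral_gaussianReal_eq_integral_smul hv]
  simp_rw [h2]
  rw [integral_const_mul, integral_gaussian, ← Real.sqrt_inv, ← Real.sqrt_inv,
    ← Real.sqrt_mul (by positivity)]
  congr 1
  have := Real.pi_pos
  field_simp

variable {M : ℕ} {n : Type*} [Fintype n]

/-- The image of a fixed unit vector under a matrix with independent `N(0, v)` entries has
independent `N(0, v)` coordinates: the coordinates are jointly Gaussian and uncorrelated. -/
lemma mulVec_gaussian_hasLaw_iIndepFun [IsProbabilityMeasure P] {v : ℝ≥0}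
    {Φ : Ω → Matrix (Fin M) n ℝ}
    (hlaw : ∀ i j, HasLaw (fun ω => Φ ω i j) (gaussianReal 0 v) P)
    (hindep : iIndepFun (fun (p : Fin M × n) ω => Φ ω p.1 p.2) P)
    {y : n → ℝ} (hy : ∑ j, y j ^ 2 = 1) :
    (∀ i, HasLaw (fun ω => (Φ ω *ᵥ y) i) (gaussianReal 0 v) P) ∧
      iIndepFun (fun i ω => (Φ ω *ᵥ y) i) P := by
  classical
  have hentry : ∀ i j, HasGaussianLaw (fun ω => Φ ω i j) P := fun i j => (hlaw i j).hasGaussianLaw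
  have hjoint : HasGaussianLaw (fun ω (p : Fin M × n) => Φ ω p.1 p.2) P :=
    hindep.hasGaussianLaw fun p => hentry p.1 p.2
  have hcoord : HasGaussianLaw (fun ω i => (Φ ω *ᵥ y) i) P :=
    hjoint.map_fun (LinearMap.toContinuousLinearMap
      { toFun := fun (a : Fin M × n → ℝ) i => ∑ j, a (i, j) * y j
        map_add' := fun a b => by ext i; simp [add_mul, Finset.sum_add_distrib]
        map_smul' := fun c a => by ext i; simp [Finset.mul_sum, mul_assoc] })
  have hcovEntry : ∀ i j k l, cov[fun ω => Φ ω i j, fun ω => Φ ω k l; P] =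
      if (i, j) = (k, l) then (v : ℝ) else 0 := by
    intro i j k l
    split_ifs with h
    · obtain ⟨rfl, rfl⟩ := Prod.mk.inj h
      rw [covariance_self (hlaw i j).aemeasurable, (hlaw i j).variance_eq, variance_id_gaussianReal]
    · exact (hindep.indepFun h).covariance_eq_zero (hentry i j).memLp_two (hentry k l).memLp_two
  have hcov : ∀ i k, cov[fun ω => (Φ ω *ᵥ y) i, fun ω => (Φ ω *ᵥ y) k; P] =
      if i = k then (v : ℝ) else 0 := by
    intro i k
    simp only [Matrix.mulVec, dotProduct]
    rw [covariance_fun_sum_fun_sum (fun j => (hentry i j).memLp_two.mul_const _)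
      (fun j => (hentry k j).memLp_two.mul_const _)]
    simp only [covariance_mul_const_left, covariance_mul_const_right, hcovEntry, Prod.mk.injEq]
    split_ifs with h
    · simp only [h, true_and, ite_mul, zero_mul, Finset.sum_ite_eq, Finset.mem_univ, if_true]
      calc ∑ j, v * y j * y j = v * ∑ j, y j ^ 2 := by
            rw [Finset.mul_sum]; exact Finset.sum_congr rfl fun j _ => by ring
        _ = v := by rw [hy, mul_one]
    · simp [h]
  refine ⟨fun i => ⟨(hcoord.eval i).aemeasurable, ?_⟩,
    hcoord.iIndepFun_of_covariance_eq_zero fun i k hik => by rw [hcov, if_neg hik]⟩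
  have hmean : ∫ ω, (Φ ω *ᵥ y) i ∂P = 0 := by
    simp only [Matrix.mulVec, dotProduct]
    rw [integral_finsetSum _ fun j _ => (hentry i j).integrable.mul_const _]
    refine Finset.sum_eq_zero fun j _ => ?_
    rw [integral_mul_const, (hlaw i j).integral_eq, integral_id_gaussianReal, zero_mul]
  rw [(hcoord.eval i).map_eq_gaussianReal, hmean,
    ← covariance_self (hcoord.eval i).aemeasurable, hcov, if_pos rfl, Real.toNNReal_coe]

/-- The moment generating function of `‖Z‖²` for `Z` with `M` independent `N(0, 1/M)` coordinates,
at the parameter `M s / 2`. -/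
lemma mgf_sum_sq_gaussian [IsProbabilityMeasure P] (hM : 0 < M) {Z : Fin M → Ω → ℝ}
    (hZ : ∀ i, HasLaw (Z i) (gaussianReal 0 (1 / (M : ℝ≥0))) P) (hindep : iIndepFun Z P)
    {s : ℝ} (hs : s < 1) :
    mgf (fun ω => ∑ i, Z i ω ^ 2) P (M * s / 2) = Real.exp (-(M / 2 * Real.log (1 - s))) := by
  have hM' : (0 : ℝ) < M := by exact_mod_cast hM
  have hv : (1 / (M : ℝ≥0)) ≠ 0 := by positivity
  have hpar : 2 * (M * s / 2) * ((1 / (M : ℝ≥0) : ℝ≥0) : ℝ) = s := by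
    push_cast
    field_simp
  have hsq : iIndepFun (fun i ω => Z i ω ^ 2) P :=
    hindep.comp (fun _ x => x ^ 2) fun _ => by fun_prop
  have hsum := hsq.mgf_sum₀ (t := M * s / 2) (fun i => (hZ i).aemeasurable.pow_const 2) Finset.univ
  have hfun : (fun ω => ∑ i, Z i ω ^ 2) = ∑ i, fun ω => Z i ω ^ 2 := by
    ext ω
    simp
  rw [hfun, hsum]
  have hone : ∀ i, mgf (fun ω => Z i ω ^ 2) P (M * s / 2) = (√(1 - s))⁻¹ := fun i => by
    rw [mgf_sq_of_hasLaw_gaussianReal hv (hZ i) (by rw [hpar]; exact hs), hpar]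
  simp only [hone, Finset.prod_const, Finset.card_univ, Fintype.card_fin]
  have h1 : 0 < 1 - s := by linarith
  have h2 : (√(1 - s))⁻¹ = Real.exp (-(Real.log (1 - s) / 2)) := by
    rw [Real.exp_neg, ← Real.log_sqrt h1.le, Real.exp_log (Real.sqrt_pos.2 h1)]
  rw [h2, ← Real.exp_nat_mul]
  congr 1
  ring

lemma log_one_add_le_sub_sq {u : ℝ} (h0 : 0 ≤ u) (h1 : u ≤ 21 / 8) :
    Real.log (1 + u) ≤ u - 4 / 29 * u ^ 2 := by
  -- The derivative `u (1 / (1 + u) - 8 / 29)` of the difference is nonnegative up to `u = 21 / 8`.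
  have hmono : MonotoneOn (fun x : ℝ => x - 4 / 29 * x ^ 2 - Real.log (1 + x))
      (Set.Icc 0 (21 / 8)) := by
    have hder : ∀ x : ℝ, 0 ≤ x → HasDerivAt (fun x : ℝ => x - 4 / 29 * x ^ 2 - Real.log (1 + x))
        (1 - 4 / 29 * (2 * x) - 1 / (1 + x)) x := fun x hx => by
      have h2 := ((hasDerivAt_id x).const_add 1).log (by simp; linarith)
      have h3 := ((hasDerivAt_id x).sub ((hasDerivAt_pow 2 x).const_mul (4 / 29))).sub h2
      refine h3.congr_deriv ?_
      simp
    refine monotoneOn_of_hasDerivWithinAt_nonneg (convex_Icc _ _)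
      (fun x hx => (hder x hx.1).continuousAt.continuousWithinAt)
      (fun x hx => (hder x (interior_subset hx).1).hasDerivWithinAt) fun x hx => ?_
    have hx' := interior_subset hx
    have hx0 : 0 ≤ x := hx'.1
    have hx1 : x ≤ 21 / 8 := hx'.2
    have : 1 - 4 / 29 * (2 * x) - 1 / (1 + x) = x * (21 / 8 - x) * (8 / 29) / (1 + x) := by
      field_simp
      ring
    rw [this]
    have := sub_nonneg.2 hx1
    positivity
  have := hmono ⟨le_rfl, by norm_num⟩ ⟨h0, h1⟩ h0
  simp only [add_zero, Real.log_one] at this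
  linarith

/-- Concentration of the squared norm: the Chernoff bounds with parameters
`(M / 2) · u / (1 + u)` and `-(M / 2) · u`. -/
lemma measureReal_abs_norm_sq_sub_one_ge_le [IsProbabilityMeasure P] (hM : 0 < M)
    {Φ : Ω → Matrix (Fin M) n ℝ}
    (hlaw : ∀ i j, HasLaw (fun ω => Φ ω i j) (gaussianReal 0 (1 / (M : ℝ≥0))) P)
    (hindep : iIndepFun (fun (p : Fin M × n) ω => Φ ω p.1 p.2) P)
    [DecidableEq n] {y : EuclideanSpace ℝ n} (hy : ‖y‖ = 1) {u : ℝ} (hu0 : 0 ≤ u)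
    (hu1 : u ≤ 21 / 8) :
    P.real {ω | u ≤ |‖Matrix.toEuclideanLin (Φ ω) y‖ ^ 2 - 1|} ≤
      2 * Real.exp (-(2 / 29 * M * u ^ 2)) := by
  have hM' : (0 : ℝ) < M := by exact_mod_cast hM
  have hy' : ∑ j, y j ^ 2 = 1 := by
    rw [← EuclideanSpace.real_norm_sq_eq, hy, one_pow]
  obtain ⟨hZ, hZi⟩ := mulVec_gaussian_hasLaw_iIndepFun hlaw hindep hy'
  have hnorm : ∀ ω, ‖Matrix.toEuclideanLin (Φ ω) y‖ ^ 2 = ∑ i, (Φ ω *ᵥ y) i ^ 2 := fun ω => by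
    rw [EuclideanSpace.real_norm_sq_eq]
    rfl
  simp only [hnorm]
  have hmgf := fun (s : ℝ) (hs : s < 1) => mgf_sum_sq_gaussian hM hZ hZi hs
  -- The Bochner integral of a non-integrable function is zero, and this one is not.
  have hint : ∀ s : ℝ, s < 1 →
      Integrable (fun ω => Real.exp (M * s / 2 * ∑ i, (Φ ω *ᵥ y) i ^ 2)) P := fun s hs =>
    Integrable.of_integral_ne_zero (by
      have := hmgf s hs
      rw [mgf] at this
      rw [this]
      exact (Real.exp_pos _).ne')
  have h1u : 0 < 1 + u := by linarith
  have hupper : P.real {ω | 1 + u ≤ ∑ i, (Φ ω *ᵥ y) i ^ 2} ≤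
      Real.exp (-(2 / 29 * M * u ^ 2)) := by
    have hs : u / (1 + u) < 1 := by rw [div_lt_one h1u]; linarith
    refine (measure_ge_le_exp_mul_mgf (1 + u) (by positivity) (hint _ hs)).trans ?_
    rw [hmgf _ hs, ← Real.exp_add, Real.exp_le_exp]
    have h1 : 1 - u / (1 + u) = (1 + u)⁻¹ := by field_simp; ring
    have h2 : -(M * (u / (1 + u)) / 2) * (1 + u) = -(M * u / 2) := by field_simp
    rw [h1, h2, Real.log_inv]
    have := mul_le_mul_of_nonneg_left (log_one_add_le_sub_sq hu0 hu1) hM'.le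
    linarith
  have hlower : P.real {ω | ∑ i, (Φ ω *ᵥ y) i ^ 2 ≤ 1 - u} ≤
      Real.exp (-(2 / 29 * M * u ^ 2)) := by
    have hs : -u < 1 := by linarith
    refine (measure_le_le_exp_mul_mgf (1 - u) ?_ (hint _ hs)).trans ?_
    · have := mul_nonneg hM'.le hu0
      linarith
    rw [hmgf _ hs, ← Real.exp_add, Real.exp_le_exp, sub_neg_eq_add]
    have hlog : u - u ^ 2 / 2 ≤ Real.log (1 + u) := by
      refine le_trans ?_ (Real.le_log_one_add_of_nonneg hu0)
      rw [le_div_iff₀ (by linarith)]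
      nlinarith [pow_nonneg hu0 3]
    have h1 := mul_le_mul_of_nonneg_left hlog hM'.le
    have h2 := mul_nonneg hM'.le (sq_nonneg u)
    linarith
  have hsub : {ω | u ≤ |∑ i, (Φ ω *ᵥ y) i ^ 2 - 1|} ⊆
      {ω | 1 + u ≤ ∑ i, (Φ ω *ᵥ y) i ^ 2} ∪ {ω | ∑ i, (Φ ω *ᵥ y) i ^ 2 ≤ 1 - u} := by
    intro ω hω
    simp only [Set.mem_union, Set.mem_ofPred_eq, le_abs] at hω ⊢
    exact hω.imp (fun h => by linarith) fun h => by linarith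
  refine (measureReal_mono hsub).trans ((measureReal_union_le _ _).trans ?_)
  linarith

end Tail

/-! ### Union bound over the column sets and the nets -/

lemma choose_le_exp_one_mul_div_pow {N K : ℕ} (hK : 1 ≤ K) :
    (N.choose K : ℝ) ≤ (Real.exp 1 * N / K) ^ K := by
  have hK' : (0 : ℝ) < K := by exact_mod_cast hK
  calc (N.choose K : ℝ) ≤ (N : ℝ) ^ K / K.factorial := Nat.choose_le_pow_div K N
    _ = (N / K : ℝ) ^ K * ((K : ℝ) ^ K / K.factorial) := by
        rw [div_pow]
        field_simp
    _ ≤ (N / K : ℝ) ^ K * Real.exp K := by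
        gcongr
        exact Real.pow_div_factorial_le_exp _ hK'.le K
    _ = (Real.exp 1 * N / K) ^ K := by
        rw [← Real.exp_one_pow K, ← mul_pow]
        ring

lemma nine_le_exp : (9 : ℝ) ≤ Real.exp (9 / 4) := by
  have h : (9 : ℝ) ^ 4 ≤ Real.exp (9 / 4) ^ 4 := by
    rw [← Real.exp_nat_mul]
    have h9 : Real.exp ((4 : ℕ) * (9 / 4)) = Real.exp 1 ^ 9 := by
      rw [← Real.exp_nat_mul]
      norm_num
    rw [h9]
    calc (9 : ℝ) ^ 4 ≤ 2.7 ^ 9 := by norm_num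
      _ ≤ Real.exp 1 ^ 9 := pow_le_pow_left₀ (by norm_num)
          (by linarith [Real.exp_one_gt_d9]) 9
  exact le_of_pow_le_pow_left₀ (by norm_num) (Real.exp_pos _).le h

/-- If the quadratic forms of all the errors `Φ_Sᵀ Φ_S - 1`, `|S| = K`, are at most `(7/8) ε` on
`1/4`-nets of the unit spheres, then all their eigenvalues are at most `ε` in modulus, and the
`2q`-norm of the `K` eigenvalues is at most `K^(1/2q) ε`. -/
lemma powerEstimate_le_of_nets {M N K q : ℕ} (hKN : K ≤ N) (hq : 1 ≤ q) {ε : ℝ}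
    (hε : 0 ≤ ε) {Φ : Matrix (Fin M) (Fin N) ℝ}
    {T : ∀ S : Finset (Fin N), Finset (EuclideanSpace ℝ S)}
    (hT1 : ∀ S, ∀ y ∈ T S, ‖y‖ = 1)
    (hT : ∀ S, ∀ x, ‖x‖ = 1 → ∃ y ∈ T S, ‖x - y‖ ≤ 1 / 4)
    (h : ∀ S : Finset (Fin N), S.card = K → ∀ y ∈ T S,
      |‖Matrix.toEuclideanLin (colSubmatrix Φ S) y‖ ^ 2 - 1| ≤ 7 / 8 * ε) :
    powerEstimate Φ K q ≤ (K : ℝ) ^ (1 / (2 * (q : ℝ))) * ε := by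
  obtain ⟨S₀, -, hS₀⟩ := Finset.exists_subset_card_eq
    (s := (Finset.univ : Finset (Fin N))) (n := K) (by simpa using hKN)
  -- An empty supremum would not be bounded by its terms; `K ≤ N` excludes it.
  have : Nonempty {S : Finset (Fin N) // S.card = K} := ⟨⟨S₀, hS₀⟩⟩
  refine ciSup_le fun S => ?_
  have hA := isHermitian_gram_sub_one (colSubmatrix Φ S.1)
  have := hA.trace_rpow_le hq hε (hA.abs_eigenvalues_le_of_net (hT1 S.1) (hT S.1) fun y hy => by
    rw [inner_gram_sub_one, hT1 S.1 y hy, one_pow]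
    exact h S.1 S.2 y hy)
  rwa [Fintype.card_coe, S.2] at this

/-- The failure probability is at most the number of column sets, times the size of the nets, times
the probability that the squared norm deviates at one point of a net. -/
lemma measureReal_lt_powerEstimate_le {Ω : Type*} [MeasurableSpace Ω] {P : Measure Ω}
    [IsProbabilityMeasure P] {M N K q : ℕ} (hM : 0 < M) (hKN : K ≤ N) (hq : 1 ≤ q) {ε : ℝ}
    (hε0 : 0 ≤ ε) (hε : ε ≤ 3) {Φ : Ω → Matrix (Fin M) (Fin N) ℝ}
    (hlaw : ∀ i j, HasLaw (fun ω => Φ ω i j) (gaussianReal 0 (1 / (M : ℝ≥0))) P)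
    (hindep : iIndepFun (fun (p : Fin M × Fin N) ω => Φ ω p.1 p.2) P) :
    P.real {ω | (K : ℝ) ^ (1 / (2 * (q : ℝ))) * ε < powerEstimate (Φ ω) K q} ≤
      N.choose K * (9 ^ K * (2 * Real.exp (-(2 / 29 * M * (7 / 8 * ε) ^ 2)))) := by
  choose T hTcard hT1 hT using
    fun S : Finset (Fin N) => exists_net_unitSphere (E := EuclideanSpace ℝ S)
  have hsub : {ω | (K : ℝ) ^ (1 / (2 * (q : ℝ))) * ε < powerEstimate (Φ ω) K q} ⊆
      ⋃ S ∈ Finset.univ.powersetCard K, ⋃ y ∈ T S,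
        {ω | 7 / 8 * ε ≤ |‖Matrix.toEuclideanLin (colSubmatrix (Φ ω) S) y‖ ^ 2 - 1|} := by
    intro ω hω
    by_contra hnot
    simp only [Set.mem_iUnion, not_exists, Finset.mem_powersetCard, Set.mem_ofPred_eq,
      not_le] at hnot
    exact absurd (powerEstimate_le_of_nets hKN hq hε0 hT1 hT fun S hS y hy =>
      (hnot S ⟨Finset.subset_univ S, hS⟩ y hy).le) (not_le.2 hω)
  have hpoint : ∀ (S : Finset (Fin N)), ∀ y ∈ T S,
      P.real {ω | 7 / 8 * ε ≤ |‖Matrix.toEuclideanLin (colSubmatrix (Φ ω) S) y‖ ^ 2 - 1|} ≤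
        2 * Real.exp (-(2 / 29 * M * (7 / 8 * ε) ^ 2)) := fun S y hy =>
    measureReal_abs_norm_sq_sub_one_ge_le (Φ := fun ω => colSubmatrix (Φ ω) S) hM
      (fun i j => hlaw i j)
      (hindep.precomp (g := fun p : Fin M × S => (p.1, (p.2 : Fin N)))
        (Function.injective_id.prodMap Subtype.val_injective))
      (hT1 S y hy) (by positivity) (by linarith)
  have hset : ∀ S ∈ Finset.univ.powersetCard K, P.real (⋃ y ∈ T S,
      {ω | 7 / 8 * ε ≤ |‖Matrix.toEuclideanLin (colSubmatrix (Φ ω) S) y‖ ^ 2 - 1|}) ≤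
        9 ^ K * (2 * Real.exp (-(2 / 29 * M * (7 / 8 * ε) ^ 2))) := fun S hS => by
    refine (measureReal_biUnion_finset_le _ _).trans
      ((Finset.sum_le_card_nsmul _ _ _ (hpoint S)).trans ?_)
    rw [nsmul_eq_mul]
    have hcard := hTcard S
    rw [finrank_euclideanSpace, Fintype.card_coe, (Finset.mem_powersetCard.1 hS).2] at hcard
    gcongr
    exact_mod_cast hcard
  refine (measureReal_mono hsub (measure_ne_top P _)).trans ((measureReal_biUnion_finset_le _ _).trans
    ((Finset.sum_le_card_nsmul _ _ _ hset).trans_eq ?_))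
  rw [nsmul_eq_mul, Finset.card_powersetCard, Finset.card_univ, Fintype.card_fin]

theorem mainTheorem6 {Ω : Type*} [MeasurableSpace Ω] (P : Measure Ω) [IsProbabilityMeasure P]
    (M N K q : ℕ) (hK : 1 ≤ K) (hKN : K ≤ N) (hq : 1 ≤ q)
    (δ : ℝ) (hδ0 : 0 < δ) (hδ : δ < 3 * (K : ℝ) ^ (1 / (2 * (q : ℝ))))
    (Φ : Ω → Matrix (Fin M) (Fin N) ℝ)
    (hlaw : ∀ i j, HasLaw (fun ω => Φ ω i j) (gaussianReal 0 (1 / (M : ℝ≥0))) P)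
    (hindep : iIndepFun (fun (p : Fin M × Fin N) ω => Φ ω p.1 p.2) P)
    (hM : 81 / δ ^ 2 * (K : ℝ) ^ (1 + 1 / (q : ℝ)) *
      Real.log (Real.exp 1 * (N : ℝ) / (K : ℝ)) ≤ (M : ℝ)) :
    (∀ ω, powerEstimate (Φ ω) K q ≤ δ → HasRIP (Φ ω) K δ) ∧
    1 - 2 * ((K : ℝ) / (Real.exp 1 * (N : ℝ))) ^ K ≤
      P.real {ω | powerEstimate (Φ ω) K q ≤ δ ∧ HasRIP (Φ ω) K δ} := by
  have hrip : ∀ ω, powerEstimate (Φ ω) K q ≤ δ → HasRIP (Φ ω) K δ :=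
    fun ω h => hasRIP_of_powerEstimate_le hKN hq h
  refine ⟨hrip, ?_⟩
  have hK' : (0 : ℝ) < K := by exact_mod_cast hK
  have hN' : (0 : ℝ) < N := by exact_mod_cast hK.trans hKN
  have hKN' : (K : ℝ) ≤ N := by exact_mod_cast hKN
  have hq' : (0 : ℝ) < q := by exact_mod_cast hq
  set L := Real.log (Real.exp 1 * (N : ℝ) / (K : ℝ)) with hL
  have hpos : 0 < Real.exp 1 * (N : ℝ) / K := by positivity
  have hexpL : Real.exp L = Real.exp 1 * N / K := Real.exp_log hpos
  have hL1 : 1 ≤ L := by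
    rw [hL, Real.le_log_iff_exp_le hpos, mul_div_assoc]
    exact le_mul_of_one_le_right (Real.exp_pos 1).le ((one_le_div hK').2 hKN')
  have hKL : (K : ℝ) ≤ K * L := le_mul_of_one_le_right hK'.le hL1
  -- A bound `ε` on the moduli of the eigenvalues of the errors yields the bound `δ = K^(1/2q) ε`.
  set r := (K : ℝ) ^ (1 / (2 * (q : ℝ))) with hr
  have hr0 : 0 < r := by positivity
  obtain ⟨ε, rfl⟩ : ∃ ε, δ = r * ε := ⟨δ / r, by field_simp⟩
  have hε0 : 0 < ε := pos_of_mul_pos_right hδ0 hr0.le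
  have hε3 : ε ≤ 3 := by
    rw [mul_comm 3] at hδ
    exact (lt_of_mul_lt_mul_left hδ hr0.le).le
  have hr2 : (K : ℝ) ^ (1 + 1 / (q : ℝ)) = K * r ^ 2 := by
    rw [Real.rpow_add hK', Real.rpow_one, hr, ← Real.rpow_natCast, ← Real.rpow_mul hK'.le]
    congr 2
    push_cast
    field_simp
  have hMε : 81 * (K * L) ≤ M * ε ^ 2 := by
    have : 81 / (r * ε) ^ 2 * (K * r ^ 2) * L = 81 * (K * L) / ε ^ 2 := by
      field_simp
    rwa [hr2, this, div_le_iff₀ (by positivity)] at hM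
  have hM0 : 0 < M := by
    have : (0 : ℝ) < M * ε ^ 2 := by linarith
    exact_mod_cast pos_of_mul_pos_left this (sq_nonneg ε)
  have hfail := measureReal_lt_powerEstimate_le (q := q) hM0 hKN hq hε0.le hε3 hlaw hindep
  rw [← hr] at hfail
  have hbound : (N.choose K : ℝ) *
      (9 ^ K * (2 * Real.exp (-(2 / 29 * M * (7 / 8 * ε) ^ 2)))) ≤
        2 * ((K : ℝ) / (Real.exp 1 * N)) ^ K := by
    have hchoose : (N.choose K : ℝ) ≤ Real.exp (K * L) := by
      rw [Real.exp_nat_mul, hexpL]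
      exact choose_le_exp_one_mul_div_pow hK
    have hnine : (9 : ℝ) ^ K ≤ Real.exp (K * (9 / 4)) := by
      rw [Real.exp_nat_mul]
      exact pow_le_pow_left₀ (by norm_num) nine_le_exp K
    have hright : ((K : ℝ) / (Real.exp 1 * N)) ^ K = Real.exp (-(K * L)) := by
      rw [Real.exp_neg, Real.exp_nat_mul, hexpL, ← inv_pow, inv_div]
    calc _ ≤ Real.exp (K * L) * (Real.exp (K * (9 / 4)) *
          (2 * Real.exp (-(2 / 29 * M * (7 / 8 * ε) ^ 2)))) := by gcongr
      _ = 2 * Real.exp (K * L + K * (9 / 4) - 2 / 29 * M * (7 / 8 * ε) ^ 2) := by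
          rw [sub_eq_add_neg, Real.exp_add, Real.exp_add]
          ring
      _ ≤ 2 * Real.exp (-(K * L)) := by
          -- `81 · (2 / 29) · (7 / 8)² > 1 + 9 / 4 + 1`.
          gcongr
          linarith
      _ = _ := by rw [hright]
  -- Subadditivity of `P` on this cover needs no measurability of the two events.
  have hcover : (Set.univ : Set Ω) ⊆
      {ω | powerEstimate (Φ ω) K q ≤ r * ε ∧ HasRIP (Φ ω) K (r * ε)} ∪
        {ω | r * ε < powerEstimate (Φ ω) K q} := fun ω _ =>
    (le_or_gt (powerEstimate (Φ ω) K q) (r * ε)).imp (fun h => ⟨h, hrip ω h⟩) id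
  have hone := (measureReal_mono (μ := P) hcover).trans (measureReal_union_le _ _)
  rw [probReal_univ] at hone
  linarith
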